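/- Let $\mathcal G$ be a strongly connected directed graph on $N\ge 1$ vertices with adjacency matrix $A=(a_{i,j})\in\{0,1\}^{N\times N}$, where $a_{i,j}=1$ if and only if there is an edge from $j$ to $i$ (self-loops are allowed unless stated otherwise). Put $d_i^{\rm in}=\sum_j a_{i,j}$, $d_j^{\rm out}=\sum_i a_{i,j}$, $D_{\rm in}=\mathrm{diag}(d_i^{\rm in})$, $D_{\rm out}=\mathrm{diag}(d_i^{\rm out})$, and let $L=D_{\rm in}^{-1/2}AD_{\rm out}^{-1/2}$ (if $N=1$ and there is no edge, $L=0$). For $x\in\mathbb R^{N\times K}$ with rows $x_1,\dots,x_N$, the Dirichlet energy is $$\mathfrak E(x)=\frac14\sum_{i,j=1}^N a_{i,j}\left\|\frac{x_i}{\sqrt{d_i^{\rm in}}}-\frac{x_j}{\sqrt{d_j^{\rm out}}}\right\|_2^2 .$$ For $M\in\mathbb R^{n\times n}$ denote its complex eigenvalues by $\lambda_1(M),\dots,\lambda_n(M)$, ordered so that $\operatorname{Re}\lambda_1(M)\le\dots\le\operatorname{Re}\lambda_n(M)$. Let $K\ge1$, let $W\in\mathbb R^{K\times K}$ be a diagonal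 matrix, and consider the heat equation (with $\alpha=1$) $$x'(t)=-L\,x(t)\,W\quad(t\ge 0),\qquad x(0)=x_0\in\mathbb R^{N\times K}.$$ With $\|\cdot\|_2$ the Frobenius norm, a solution $x$ is called highest-frequency-dominant (HFD) if $\mathfrak E(x(t)/\|x(t)\|_2)\to\frac12\operatorname{Re}\lambda_N(I-L)$ as $t\to\infty$, and lowest-frequency-dominant (LFD) if $\mathfrak E(x(t)/\|x(t)\|_2)\to\frac12\operatorname{Re}\lambda_1(I-L)$ as $t\to\infty$. Then $\lambda_N(L)$ is real, and the following hold. 1. Suppose that $\lambda_1(L)$ is the only eigenvalue of $L$ (as a complex number, not counting multiplicity) whose real part is minimal. If $\lambda_K(W)\operatorname{Re}\lambda_1(L)<\lambda_1(W)\lambda_N(L)$, then for almost all $x_0\in\mathbb R^{N\times K}$ (with respect to Lebesgue measure) the initial value problem has a solution and every solution of it is HFD. 2. Suppose that $\mathcal G$ has no self-loops or, alternatively, that $\operatorname{Re}\lambda_1(L)\le 0$. If $\lambda_K(W)\operatorname{Re}\lambda_1(L)>\lambda_1(W)\lambda_N(L)$, then for almost all $x_0\in\mathbb R^{N\times K}$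 the initial value problem has a solution and every solution of it is LFD. -/

import Mathlib

open Filter Topology MeasureTheory

noncomputable section

namespace FracGraph

/-- A digraph is strongly connected if every vertex can be reached from every vertex
along a directed path. -/
def StronglyConnected {V : Type*} (G : Digraph V) : Prop :=
  ∀ i j : V, Relation.ReflTransGen G.Adj i j

open Classical in
/-- Adjacency matrix, `a i j = 1` if there is an edge directed from `j` to `i`, else `0`. -/
def adj {N : ℕ} (G : Digraph (Fin N)) : Matrix (Fin N) (Fin N) ℝ :=
  Matrix.of fun i j => if G.Adj j i then 1 else 0

/-- In-degrees, the diagonal of `diag (A 1)`. -/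
def inDeg {N : ℕ} (G : Digraph (Fin N)) (i : Fin N) : ℝ := ∑ j, adj G i j

/-- Out-degrees, the diagonal of `diag (Aᵀ 1)`. -/
def outDeg {N : ℕ} (G : Digraph (Fin N)) (j : Fin N) : ℝ := ∑ i, adj G i j

/-- The symmetrically normalized adjacency `L = D_in ^ (-1/2) * A * D_out ^ (-1/2)`. -/
def sna {N : ℕ} (G : Digraph (Fin N)) : Matrix (Fin N) (Fin N) ℝ :=
  Matrix.diagonal (fun i => (√(inDeg G i))⁻¹) * adj G *
    Matrix.diagonal (fun j => (√(outDeg G j))⁻¹)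

/-- The symmetrically normalized Laplacian `I - L`. -/
def snl {N : ℕ} (G : Digraph (Fin N)) : Matrix (Fin N) (Fin N) ℝ := 1 - sna G

/-- The Dirichlet energy of node features `x`. -/
def dirichletEnergy {N K : ℕ} (G : Digraph (Fin N)) (x : Matrix (Fin N) (Fin K) ℝ) : ℝ :=
  (1 / 4) * ∑ i, ∑ j, adj G i j *
    ∑ k, (x i k / √(inDeg G i) - x j k / √(outDeg G j)) ^ 2

/-- The Frobenius norm. -/
def frob {N K : ℕ} (x : Matrix (Fin N) (Fin K) ℝ) : ℝ := √(∑ i, ∑ k, x i k ^ 2)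

/-- The normalized features `x / ‖x‖₂` (Frobenius norm). -/
def normalized {N K : ℕ} (x : Matrix (Fin N) (Fin K) ℝ) : Matrix (Fin N) (Fin K) ℝ :=
  (frob x)⁻¹ • x

/-- The set of complex eigenvalues of a real square matrix. -/
def eigenvalues {n : ℕ} (M : Matrix (Fin n) (Fin n) ℝ) : Set ℂ :=
  spectrum ℂ (M.map (fun a : ℝ => (a : ℂ)))

/-- `μ` is a first eigenvalue `λ₁(M)` in the ascending order of real parts. -/
def IsLowestEigenvalue {n : ℕ} (M : Matrix (Fin n) (Fin n) ℝ) (μ : ℂ) : Prop :=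
  μ ∈ eigenvalues M ∧ ∀ ν ∈ eigenvalues M, μ.re ≤ ν.re

/-- `μ` is a last eigenvalue `λₙ(M)` in the ascending order of real parts. -/
def IsHighestEigenvalue {n : ℕ} (M : Matrix (Fin n) (Fin n) ℝ) (μ : ℂ) : Prop :=
  μ ∈ eigenvalues M ∧ ∀ ν ∈ eigenvalues M, ν.re ≤ μ.re

/-- `x` solves the heat equation `x'(t) = - L x(t) W` for `t ≥ 0` (one-sided derivative
at `t = 0`) with initial value `x(0) = x₀`. -/
def IsHeatSolution {N K : ℕ} (G : Digraph (Fin N)) (W : Matrix (Fin K) (Fin K) ℝ)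
    (x₀ : Matrix (Fin N) (Fin K) ℝ) (x : ℝ → Matrix (Fin N) (Fin K) ℝ) : Prop :=
  x 0 = x₀ ∧ ∀ t : ℝ, 0 ≤ t → ∀ i k,
    HasDerivWithinAt (fun s => x s i k) ((-(sna G * x t * W)) i k) (Set.Ici 0) t

/-- `lam`-frequency-dominance: the normalized Dirichlet energy tends to `lam / 2`. -/
def IsFreqDominant {N K : ℕ} (G : Digraph (Fin N)) (x : ℝ → Matrix (Fin N) (Fin K) ℝ)
    (lam : ℝ) : Prop :=
  Tendsto (fun t => dirichletEnergy G (normalized (x t))) atTop (𝓝 (lam / 2))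

/-- Lowest-frequency-dominance: `Re λ₁(I - L)`-frequency-dominance. -/
def IsLFD {N K : ℕ} (G : Digraph (Fin N)) (x : ℝ → Matrix (Fin N) (Fin K) ℝ) : Prop :=
  ∃ μ : ℂ, IsLowestEigenvalue (snl G) μ ∧ IsFreqDominant G x μ.re

/-- Highest-frequency-dominance: `Re λ_N(I - L)`-frequency-dominance. -/
def IsHFD {N K : ℕ} (G : Digraph (Fin N)) (x : ℝ → Matrix (Fin N) (Fin K) ℝ) : Prop :=
  ∃ μ : ℂ, IsHighestEigenvalue (snl G) μ ∧ IsFreqDominant G x μ.re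

end FracGraph

end

/-!
Since `L` is entrywise nonnegative, Perron–Frobenius applies: `Re λ_N(L)` is itself an eigenvalue
and bounds the modulus of every eigenvalue, so `λ_N(L)` is real and is the only eigenvalue with
maximal real part.

For `W = diag(w)` the columns of `x` evolve independently, column `k` by `exp(-t w_k L)`. For
generic `x₀` each column has a nonzero component in every generalized eigenspace of `L`, so a
column with `w_k > 0` (resp. `w_k < 0`) aligns with the eigenspace of `λ_1(L)` (resp. `λ_N(L)`).
The inequality between the products of extreme eigenvalues makes the fastest column of one of these
two families outgrow every column outside it; call the eigenvalue of that family `r`. Then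
`L x - r x = o(‖x‖)`, and since `𝔈(x / ‖x‖) = (1 - r) / 2 - ⟨x, L x - r x⟩ / (2 ‖x‖²)`, the
normalized energy tends to `(1 - r) / 2`.
-/

namespace FracGraph

open Matrix
open scoped Pointwise

section Perron

theorem exists_seq_gt_tendsto {m n : Type*} (M : Matrix m n ℝ) :
    ∃ P : ℕ → Matrix m n ℝ, (∀ k i j, M i j < P k i j) ∧ (∀ k i j, P k i j ≤ M i j + 1) ∧
      Tendsto P atTop (𝓝 M) := by
  refine ⟨fun k => M + of fun _ _ => 1 / ((k : ℝ) + 1),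
    fun k i j => lt_add_of_pos_right _ Nat.one_div_pos_of_nat, fun k i j => ?_,
    tendsto_pi_nhds.2 fun i => tendsto_pi_nhds.2 fun j => ?_⟩
  · simpa using Nat.one_div_le_one_div (α := ℝ) (Nat.zero_le k)
  · simpa using (tendsto_one_div_add_atTop_nhds_zero_nat (𝕜 := ℝ)).const_add (M i j)

variable {ι : Type*} [Fintype ι] {M : Matrix ι ι ℝ} {x : ι → ℝ} {r s : ℝ}

/-- `x` is a nonnegative eigenvector of `M`, normalized in the `ℓ¹` norm, whose eigenvalue `r` is
maximal in the Collatz–Wielandt sense. -/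
def IsPerronPair (M : Matrix ι ι ℝ) (r : ℝ) (x : ι → ℝ) : Prop :=
  x ∈ stdSimplex ℝ ι ∧ M *ᵥ x = r • x ∧ ∀ (s : ℝ) y, 0 ≤ y → y ≠ 0 → s • y ≤ M *ᵥ y → s ≤ r

theorem ne_zero_of_mem_stdSimplex (hx : x ∈ stdSimplex ℝ ι) : x ≠ 0 := by
  rintro rfl
  simpa using hx.2

theorem inv_sum_smul_mem_stdSimplex (hx : 0 ≤ x) (h0 : x ≠ 0) :
    (∑ i, x i)⁻¹ • x ∈ stdSimplex ℝ ι := by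
  have hsum : 0 < ∑ i, x i := Fintype.sum_pos (lt_of_le_of_ne hx h0.symm)
  refine ⟨fun i => mul_nonneg (inv_nonneg.2 hsum.le) (hx i), ?_⟩
  simp only [Pi.smul_apply, smul_eq_mul, ← Finset.mul_sum, inv_mul_cancel₀ hsum.ne']

theorem mulVec_nonneg (hM : ∀ i j, 0 ≤ M i j) (hx : 0 ≤ x) : 0 ≤ M *ᵥ x := fun i =>
  Finset.sum_nonneg fun j _ => mul_nonneg (hM i j) (hx j)

theorem mulVec_pos (hM : ∀ i j, 0 < M i j) (hx : 0 ≤ x) (h0 : x ≠ 0) (i : ι) :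
    0 < (M *ᵥ x) i := by
  obtain ⟨j, hj⟩ := Function.ne_iff.1 h0
  exact Finset.sum_pos' (fun j _ => mul_nonneg (hM i j).le (hx j))
    ⟨j, Finset.mem_univ j, mul_pos (hM i j) (lt_of_le_of_ne (hx j) hj.symm)⟩

theorem le_sum_sum_of_smul_le_mulVec (hM : ∀ i j, 0 ≤ M i j) (hx : x ∈ stdSimplex ℝ ι)
    (h : s • x ≤ M *ᵥ x) : s ≤ ∑ i, ∑ j, M i j :=
  calc s = ∑ i, s * x i := by rw [← Finset.mul_sum, hx.2, mul_one]
    _ ≤ ∑ i, ∑ j, M i j * x j := Finset.sum_le_sum fun i _ => h i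
    _ ≤ ∑ i, ∑ j, M i j := by
      gcongr with i _ j _
      exact mul_le_of_le_one_right (hM i j) (mem_Icc_of_mem_stdSimplex hx j).2

theorem exists_stdSimplex_isMax_smul_le_mulVec [Nonempty ι] (hM : ∀ i j, 0 ≤ M i j) :
    ∃ r : ℝ, ∃ x ∈ stdSimplex ℝ ι, r • x ≤ M *ᵥ x ∧
      ∀ (s : ℝ) y, 0 ≤ y → y ≠ 0 → s • y ≤ M *ᵥ y → s ≤ r := by
  classical
  set S : Set (ℝ × (ι → ℝ)) :=
    (Set.Icc 0 (∑ i, ∑ j, M i j) ×ˢ stdSimplex ℝ ι) ∩ {p | p.1 • p.2 ≤ M *ᵥ p.2}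
  have hS : IsCompact S := (isCompact_Icc.prod (isCompact_stdSimplex ℝ ι)).inter_right
    (isClosed_le (by fun_prop) (by fun_prop))
  have hne : S.Nonempty := by
    obtain ⟨i⟩ := ‹Nonempty ι›
    have hi := single_mem_stdSimplex ℝ i
    have h0 : (0 : ℝ) • Pi.single i 1 ≤ M *ᵥ Pi.single i 1 := by
      simpa only [zero_smul] using mulVec_nonneg hM hi.1
    exact ⟨(0, _), ⟨⟨le_rfl, le_sum_sum_of_smul_le_mulVec hM hi h0⟩, hi⟩, h0⟩
  obtain ⟨⟨r, x⟩, ⟨⟨hr, hx⟩, hle⟩, hmax⟩ := hS.exists_isMaxOn hne continuousOn_fst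
  refine ⟨r, x, hx, hle, fun s y hy hy0 hs => ?_⟩
  by_contra! hlt
  have hmem := inv_sum_smul_mem_stdSimplex hy hy0
  have hle : s • (∑ i, y i)⁻¹ • y ≤ M *ᵥ ((∑ i, y i)⁻¹ • y) := by
    rw [smul_comm, mulVec_smul]
    exact smul_le_smul_of_nonneg_left hs (inv_nonneg.2 (Finset.sum_nonneg fun i _ => hy i))
  have hmemS : (s, (∑ i, y i)⁻¹ • y) ∈ S :=
    ⟨⟨⟨hr.1.trans hlt.le, le_sum_sum_of_smul_le_mulVec hM hmem hle⟩, hmem⟩, hle⟩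
  exact hlt.not_ge (hmax hmemS)

theorem exists_isPerronPair_of_pos [Nonempty ι] (hM : ∀ i j, 0 < M i j) :
    ∃ r x, IsPerronPair M r x := by
  obtain ⟨r, x, hx, hle, hmax⟩ := exists_stdSimplex_isMax_smul_le_mulVec fun i j => (hM i j).le
  refine ⟨r, x, hx, ?_, hmax⟩
  by_contra hne
  -- a nonzero defect `M x - r x` is made strictly positive by `M`, so `M x` beats the maximum
  have hpos : ∀ i, 0 < (M *ᵥ (M *ᵥ x - r • x)) i :=
    mulVec_pos hM (sub_nonneg.2 hle) (sub_ne_zero.2 hne)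
  have hsmall : ∀ᶠ ε in 𝓝[>] (0 : ℝ), ∀ i, ε * (M *ᵥ x) i < (M *ᵥ (M *ᵥ x - r • x)) i :=
    eventually_all.2 fun i => nhdsWithin_le_nhds <|
      (continuous_mul_const ((M *ᵥ x) i)).tendsto' 0 0 (zero_mul _) |>.eventually_lt_const (hpos i)
  obtain ⟨ε, hε, hε0 : 0 < ε⟩ := (hsmall.and self_mem_nhdsWithin).exists
  have hbeat : (r + ε) • (M *ᵥ x) ≤ M *ᵥ (M *ᵥ x) := fun i => by
    have := (hε i).le
    rw [mulVec_sub, mulVec_smul, Pi.sub_apply, Pi.smul_apply, smul_eq_mul] at this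
    rw [Pi.smul_apply, smul_eq_mul, add_mul]
    linarith
  have hMx := mulVec_pos hM hx.1 (ne_zero_of_mem_stdSimplex hx)
  have hMx0 : M *ᵥ x ≠ 0 := fun h =>
    (hMx (Classical.arbitrary ι)).ne' (congrFun h _)
  linarith [hmax _ _ (fun i => (hMx i).le) hMx0 hbeat]

theorem exists_isPerronPair [Nonempty ι] (hM : ∀ i j, 0 ≤ M i j) :
    ∃ r x, IsPerronPair M r x := by
  obtain ⟨P, hMP, hP, hPlim⟩ := exists_seq_gt_tendsto M
  have hP0 : ∀ k i j, 0 < P k i j := fun k i j => (hM i j).trans_lt (hMP k i j)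
  choose r x hx heig hmax using fun k => exists_isPerronPair_of_pos (hP0 k)
  have hr0 : ∀ k, 0 ≤ r k := fun k =>
    hmax k 0 (x k) (hx k).1 (ne_zero_of_mem_stdSimplex (hx k)) <| by
      simpa only [zero_smul] using mulVec_nonneg (fun i j => (hP0 k i j).le) (hx k).1
  have hr1 : ∀ k, r k ≤ ∑ i, ∑ j, (M i j + 1) := fun k =>
    (le_sum_sum_of_smul_le_mulVec (fun i j => (hP0 k i j).le) (hx k) (heig k).ge).trans <|
      Finset.sum_le_sum fun i _ => Finset.sum_le_sum fun j _ => hP k i j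
  obtain ⟨⟨r', x'⟩, ⟨-, hx'⟩, φ, hφ, hlim⟩ :=
    (isCompact_Icc.prod (isCompact_stdSimplex ℝ ι)).tendsto_subseq
      (x := fun k => (r k, x k)) fun k => ⟨⟨hr0 k, hr1 k⟩, hx k⟩
  have hrlim : Tendsto (fun k => r (φ k)) atTop (𝓝 r') := hlim.fst_nhds
  have hxlim : Tendsto (fun k => x (φ k)) atTop (𝓝 x') := hlim.snd_nhds
  have hMxlim : Tendsto (fun k => P (φ k) *ᵥ x (φ k)) atTop (𝓝 (M *ᵥ x')) :=
    ((continuous_fst.matrix_mulVec continuous_snd).tendsto (M, x')).comp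
      ((hPlim.comp hφ.tendsto_atTop).prodMk_nhds hxlim)
  refine ⟨r', x', hx', ?_, fun s y hy hy0 hs => ?_⟩
  · exact tendsto_nhds_unique hMxlim ((hrlim.smul hxlim).congr fun k => (heig _).symm)
  · refine ge_of_tendsto' hrlim fun k => hmax _ s y hy hy0 (hs.trans fun i => ?_)
    exact Finset.sum_le_sum fun j _ => mul_le_mul_of_nonneg_right (hMP _ i j).le (hy j)

end Perron

section Eigenvalues

variable {n : ℕ} {M : Matrix (Fin n) (Fin n) ℝ} {r : ℝ} {l : ℂ}

theorem mem_eigenvalues_iff_exists_mulVec_eq : l ∈ eigenvalues M ↔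
    ∃ u ≠ 0, M.map (fun a : ℝ => (a : ℂ)) *ᵥ u = l • u := by
  rw [eigenvalues, ← Matrix.spectrum_toLin', ← Module.End.hasEigenvalue_iff_mem_spectrum]
  refine ⟨fun h => ?_, fun ⟨u, hu0, hu⟩ => ?_⟩
  · obtain ⟨u, hu⟩ := h.exists_hasEigenvector
    exact ⟨u, hu.2, by simpa using hu.apply_eq_smul⟩
  · exact Module.End.hasEigenvalue_of_hasEigenvector
      ⟨Module.End.mem_eigenspace_iff.2 (by simpa using hu), hu0⟩

theorem IsPerronPair.mem_eigenvalues {x : Fin n → ℝ} (h : IsPerronPair M r x) :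
    (r : ℂ) ∈ eigenvalues M := by
  refine mem_eigenvalues_iff_exists_mulVec_eq.2 ⟨fun i => (x i : ℂ), fun h0 => ?_, ?_⟩
  · exact ne_zero_of_mem_stdSimplex h.1 (funext fun i => Complex.ofReal_eq_zero.1 (congrFun h0 i))
  · ext i
    simpa [mulVec, dotProduct] using congrArg Complex.ofReal (congrFun h.2.1 i)

theorem IsPerronPair.norm_le {x : Fin n → ℝ} (h : IsPerronPair M r x) (hM : ∀ i j, 0 ≤ M i j)
    (hl : l ∈ eigenvalues M) : ‖l‖ ≤ r := by
  obtain ⟨u, hu0, hu⟩ := mem_eigenvalues_iff_exists_mulVec_eq.1 hl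
  refine h.2.2 ‖l‖ (fun i => ‖u i‖) (fun i => norm_nonneg _) (fun h0 => hu0 ?_) fun i => ?_
  · exact funext fun i => norm_eq_zero.1 (congrFun h0 i)
  · calc ‖l‖ * ‖u i‖ = ‖∑ j, (M i j : ℂ) * u j‖ := by
          rw [← norm_mul, ← smul_eq_mul, ← Pi.smul_apply, ← hu]
          rfl
      _ ≤ ∑ j, ‖(M i j : ℂ) * u j‖ := norm_sum_le _ _
      _ = ∑ j, M i j * ‖u j‖ := by
          simp only [norm_mul, Complex.norm_real, Real.norm_of_nonneg (hM i _)]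

theorem IsHighestEigenvalue.norm_le [NeZero n] (hM : ∀ i j, 0 ≤ M i j)
    (hl : IsHighestEigenvalue M l) {μ : ℂ} (hμ : μ ∈ eigenvalues M) : ‖μ‖ ≤ l.re := by
  obtain ⟨r, x, h⟩ := exists_isPerronPair hM
  exact (h.norm_le hM hμ).trans (hl.2 r h.mem_eigenvalues)

theorem IsHighestEigenvalue.eq_re_of_re_eq [NeZero n] (hM : ∀ i j, 0 ≤ M i j)
    (hl : IsHighestEigenvalue M l) {μ : ℂ} (hμ : μ ∈ eigenvalues M) (hre : μ.re = l.re) :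
    μ = l.re := by
  have him : |μ.re| = ‖μ‖ := le_antisymm (Complex.abs_re_le_norm μ)
    ((hl.norm_le hM hμ).trans (hre ▸ le_abs_self μ.re))
  exact Complex.ext hre (by simpa using Complex.abs_re_eq_norm.1 him)

theorem IsLowestEigenvalue.card_mul_re_le_trace (hl : IsLowestEigenvalue M l) :
    n * l.re ≤ M.trace := by
  set Mc : Matrix (Fin n) (Fin n) ℂ := M.map (fun a : ℝ => (a : ℂ))
  have hroot : ∀ z ∈ Mc.charpoly.roots.map Complex.re, l.re ≤ z := by
    simp only [Multiset.mem_map, forall_exists_index, and_imp, forall_apply_eq_imp_iff₂]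
    exact fun z hz => hl.2 z <|
      Matrix.mem_spectrum_iff_isRoot_charpoly.2 (Polynomial.isRoot_of_mem_roots hz)
  have hcard : Mc.charpoly.roots.card = n := by
    rw [IsAlgClosed.card_roots_eq_natDegree, charpoly_natDegree_eq_dim, Fintype.card_fin]
  have htrace : (Mc.charpoly.roots.map Complex.re).sum = M.trace := by
    rw [← Complex.ofReal_re M.trace, show (M.trace : ℂ) = Mc.trace from ?_,
      trace_eq_sum_roots_charpoly, ← Complex.coe_reAddGroupHom, ← map_multiset_sum]
    simp [Mc, Matrix.trace]
  simpa [hcard, htrace] using Multiset.card_nsmul_le_sum hroot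

theorem eigenvalues_one_sub : eigenvalues (1 - M) = ({1} : Set ℂ) - eigenvalues M := by
  have hmap : (1 - M).map (fun a : ℝ => (a : ℂ)) =
      algebraMap ℂ _ 1 - M.map (fun a : ℝ => (a : ℂ)) := by
    rw [map_one]
    ext i j
    by_cases hij : i = j <;> simp [one_apply, hij]
  rw [eigenvalues, hmap, ← spectrum.singleton_sub_eq, eigenvalues]

theorem IsLowestEigenvalue.one_sub (h : IsLowestEigenvalue M l) :
    IsHighestEigenvalue (1 - M) (1 - l) := by
  rw [IsHighestEigenvalue, eigenvalues_one_sub, Set.singleton_sub]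
  refine ⟨Set.mem_image_of_mem _ h.1, Set.forall_mem_image.2 fun μ hμ => ?_⟩
  exact sub_le_sub_left (h.2 μ hμ) 1

theorem IsHighestEigenvalue.one_sub (h : IsHighestEigenvalue M l) :
    IsLowestEigenvalue (1 - M) (1 - l) := by
  rw [IsLowestEigenvalue, eigenvalues_one_sub, Set.singleton_sub]
  refine ⟨Set.mem_image_of_mem _ h.1, Set.forall_mem_image.2 fun μ hμ => ?_⟩
  exact sub_le_sub_left (h.2 μ hμ) 1

theorem conj_mem_eigenvalues (hl : l ∈ eigenvalues M) : (starRingEnd ℂ) l ∈ eigenvalues M := by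
  obtain ⟨u, hu0, hu⟩ := mem_eigenvalues_iff_exists_mulVec_eq.1 hl
  refine mem_eigenvalues_iff_exists_mulVec_eq.2 ⟨star u, star_ne_zero.2 hu0, ?_⟩
  ext i
  simpa [mulVec, dotProduct] using congrArg (starRingEnd ℂ) (congrFun hu i)

theorem eigenvalues_diagonal (w : Fin n → ℝ) :
    eigenvalues (diagonal w) = Set.range fun k => (w k : ℂ) := by
  rw [eigenvalues, diagonal_map Complex.ofReal_zero, spectrum_diagonal]

theorem isLowestEigenvalue_diagonal_iff {w : Fin n → ℝ} {a : ℝ} :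
    IsLowestEigenvalue (diagonal w) a ↔ IsLeast (Set.range w) a := by
  simp [IsLowestEigenvalue, eigenvalues_diagonal, IsLeast, mem_lowerBounds]

theorem isHighestEigenvalue_diagonal_iff {w : Fin n → ℝ} {a : ℝ} :
    IsHighestEigenvalue (diagonal w) a ↔ IsGreatest (Set.range w) a := by
  simp [IsHighestEigenvalue, eigenvalues_diagonal, IsGreatest, mem_upperBounds]

end Eigenvalues

section LinearFlow

open Asymptotics Module.End
open scoped Nat

variable {E : Type*} [NormedAddCommGroup E] [NormedSpace ℂ E] {A : E →L[ℂ] E} {μ ρ : ℂ} {v : E}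

theorem mem_maxGenEigenspace_iff_exists_pow_sub_smul :
    v ∈ maxGenEigenspace (A : E →ₗ[ℂ] E) μ ↔ ∃ n : ℕ, ((A - μ • 1) ^ n) v = 0 := by
  rw [mem_maxGenEigenspace]
  refine exists_congr fun n => ?_
  rw [← ContinuousLinearMap.coe_coe ((A - μ • 1) ^ n), ContinuousLinearMap.toLinearMap_pow]
  rfl

theorem apply_pow_sub_smul_eq_smul {n : ℕ} (h : ((A - μ • 1) ^ (n + 1)) v = 0) :
    A (((A - μ • 1) ^ n) v) = μ • ((A - μ • 1) ^ n) v := by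
  rw [pow_succ', mul_apply_eq_comp] at h
  simpa [sub_eq_zero] using h

theorem norm_exp_ofReal_mul (t : ℝ) (μ : ℂ) : ‖Complex.exp (t * μ)‖ = Real.exp (μ.re * t) := by
  rw [Complex.norm_exp, Complex.re_ofReal_mul, mul_comm]

theorem exp_ofReal_mul_isTheta (μ : ℂ) :
    (fun t : ℝ => Complex.exp (t * μ)) =Θ[atTop] fun t => Real.exp (μ.re * t) :=
  .of_norm_eventuallyEq_norm <| .of_forall fun t => by
    simp only [norm_exp_ofReal_mul, Real.norm_of_nonneg (Real.exp_pos _).le]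

theorem ofReal_pow_div_smul_isBigO (k : ℕ) (c : ℂ) (v : E) :
    (fun t : ℝ => ((t : ℂ) ^ k / c) • v) =O[atTop] fun t => t ^ k :=
  IsBigO.of_bound (‖c‖⁻¹ * ‖v‖) <| .of_forall fun t => by
    rw [norm_smul, norm_div, norm_pow, norm_pow, Complex.norm_real]
    exact le_of_eq (by ring)

theorem exp_re_mul_isBigO_exp_mul_pow_smul (n : ℕ) {z : E} (hz : z ≠ 0) (ρ : ℂ) :
    (fun t : ℝ => Real.exp (ρ.re * t)) =O[atTop]
      fun t => (Complex.exp (t * ρ) * (t ^ n / n !)) • z := by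
  refine IsBigO.of_bound (n ! * ‖z‖⁻¹) ?_
  filter_upwards [eventually_ge_atTop 1] with t ht
  have hz : ‖z‖ ≠ 0 := norm_ne_zero_iff.2 hz
  have hnorm : ‖(Complex.exp (t * ρ) * (t ^ n / n !)) • z‖ =
      Real.exp (ρ.re * t) * (t ^ n / n !) * ‖z‖ := by
    rw [norm_smul, norm_mul, norm_div, norm_pow, Complex.norm_real, Complex.norm_natCast,
      norm_exp_ofReal_mul, Real.norm_of_nonneg (zero_le_one.trans ht)]
  rw [hnorm, Real.norm_of_nonneg (Real.exp_pos _).le]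
  field_simp
  exact one_le_pow₀ ht

theorem isLittleO_of_isEquivalent_smul {B : E →L[ℂ] E} {y : ℝ → E} {c : ℝ → ℂ} {z : E}
    (hy : y ~[atTop] fun t => c t • z) (hz : B z = 0) :
    (fun t => B (y t)) =o[atTop] y := by
  have hBy : (fun t => B (y t - c t • z)) =o[atTop] fun t => c t • z :=
    (B.isBigO_comp _ atTop).trans_isLittleO hy.isLittleO
  simpa [hz] using hBy.trans_isBigO hy.isBigO_symm

variable [CompleteSpace E]

theorem exp_smul_apply_of_pow_sub_smul_eq_zero {n : ℕ} (hv : ((A - μ • 1) ^ n) v = 0) (s : ℂ) :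
    NormedSpace.exp (s • A) v =
      Complex.exp (s * μ) • ∑ k ∈ Finset.range n, (s ^ k / k !) • ((A - μ • 1) ^ k) v := by
  let := NormedAlgebra.restrictScalars ℚ ℂ (E →L[ℂ] E)
  set B := A - μ • 1 with hB
  have hsplit : s • A = algebraMap ℂ (E →L[ℂ] E) (s * μ) + s • B := by
    rw [hB, Algebra.algebraMap_eq_smul_one, smul_sub, smul_smul, add_sub_cancel]
  have hseries : HasSum (fun k : ℕ => (s ^ k / k !) • (B ^ k) v) (NormedSpace.exp (s • B) v) := by
    convert (ContinuousLinearMap.apply ℂ E v).hasSum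
      (NormedSpace.exp_series_hasSum_exp' (𝕂 := ℂ) (s • B)) using 2 with k
    · simp [smul_pow, smul_smul, div_eq_inv_mul]
    · rfl
  have hterms : ∀ k ∉ Finset.range n, (s ^ k / k !) • (B ^ k) v = 0 := fun k hk => by
    obtain ⟨m, rfl⟩ := Nat.exists_eq_add_of_le' (not_lt.1 (mt Finset.mem_range.2 hk))
    rw [pow_add B, mul_apply_eq_comp, hv, map_zero, smul_zero]
  rw [hsplit, NormedSpace.exp_add_of_commute (Algebra.commutes _ _),
    ← NormedSpace.algebraMap_exp_comm, ← Complex.exp_eq_exp_ℂ, Algebra.algebraMap_eq_smul_one,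
    smul_mul_assoc, one_mul, _root_.smul_apply,
    hseries.unique (hasSum_sum_of_ne_finset_zero hterms)]

theorem hasDerivAt_exp_smul_apply (A : E →L[ℂ] E) (v : E) (t : ℝ) :
    HasDerivAt (fun t : ℝ => NormedSpace.exp ((t : ℂ) • A) v)
      (A (NormedSpace.exp ((t : ℂ) • A) v)) t := by
  have hexp : HasDerivAt (fun s : ℂ => NormedSpace.exp (s • A) v)
      (A (NormedSpace.exp ((t : ℂ) • A) v)) (t : ℂ) := by
    simpa using (hasDerivAt_exp_smul_const' A (t : ℂ)).clm_apply (hasDerivAt_const _ v)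
  simpa [Function.comp_def] using hexp.scomp t Complex.ofRealCLM.hasDerivAt

theorem eq_exp_smul_apply {y : ℝ → E}
    (hy : ∀ t, 0 ≤ t → HasDerivWithinAt y (A (y t)) (Set.Ici 0) t) {t : ℝ} (ht : 0 ≤ t) :
    y t = NormedSpace.exp ((t : ℂ) • A) (y 0) := by
  have hexp := hasDerivAt_exp_smul_apply A (y 0)
  refine ODE_solution_unique (v := fun _ => A) (K := ‖A‖₊) (fun _ => A.lipschitz)
    (fun s hs => (hy s hs.1).continuousWithinAt.mono Set.Icc_subset_Ici_self)
    (fun s hs => (hy s hs.1).mono (Set.Ici_subset_Ici.2 hs.1))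
    (fun s _ => (hexp s).continuousAt.continuousWithinAt)
    (fun s _ => (hexp s).hasDerivWithinAt) ?_ ⟨ht, le_rfl⟩
  simp

theorem exp_smul_apply_isLittleO_of_mem_maxGenEigenspace {c : ℝ}
    (hv : v ∈ maxGenEigenspace (A : E →ₗ[ℂ] E) μ) (hc : μ.re < c) :
    (fun t : ℝ => NormedSpace.exp ((t : ℂ) • A) v) =o[atTop] fun t => Real.exp (c * t) := by
  obtain ⟨n, hn⟩ := mem_maxGenEigenspace_iff_exists_pow_sub_smul.1 hv
  simp only [exp_smul_apply_of_pow_sub_smul_eq_zero hn]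
  refine ((exp_ofReal_mul_isTheta μ).isBigO.smul_isLittleO <| IsLittleO.fun_sum fun k _ =>
    (ofReal_pow_div_smul_isBigO k _ _).trans_isLittleO
      (isLittleO_pow_exp_pos_mul_atTop k (sub_pos.2 hc))).congr_right fun t => ?_
  rw [smul_eq_mul, ← Real.exp_add]
  ring_nf

theorem exp_smul_apply_isLittleO_of_mem_iSup {P : ℂ → Prop} {c : ℝ}
    (hv : v ∈ ⨆ (μ : ℂ) (_ : P μ), maxGenEigenspace (A : E →ₗ[ℂ] E) μ)
    (hP : ∀ μ, P μ → HasEigenvalue (A : E →ₗ[ℂ] E) μ → μ.re < c) :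
    (fun t : ℝ => NormedSpace.exp ((t : ℂ) • A) v) =o[atTop] fun t => Real.exp (c * t) := by
  induction hv using Submodule.iSup_induction' with
  | mem μ v hv =>
    induction hv using Submodule.iSup_induction' with
    | mem hμ v hv =>
      by_cases h : HasEigenvalue (A : E →ₗ[ℂ] E) μ
      · exact exp_smul_apply_isLittleO_of_mem_maxGenEigenspace hv (hP μ hμ h)
      · have hbot : maxGenEigenspace (A : E →ₗ[ℂ] E) μ = ⊥ := not_not.1 fun hne =>
          h (HasUnifEigenvalue.lt zero_lt_one hne)
        rw [hbot, Submodule.mem_bot] at hv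
        simp [hv]
    | zero => simp
    | add v w _ _ hv hw => simpa using hv.add hw
  | zero => simp
  | add v w _ _ hv hw => simpa using hv.add hw

theorem exp_smul_apply_isEquivalent_of_pow_sub_smul {n : ℕ} (h0 : ((A - μ • 1) ^ n) v ≠ 0)
    (h1 : ((A - μ • 1) ^ (n + 1)) v = 0) :
    (fun t : ℝ => NormedSpace.exp ((t : ℂ) • A) v) ~[atTop]
      fun t => (Complex.exp (t * μ) * (t ^ n / n !)) • ((A - μ • 1) ^ n) v := by
  have hlead : (fun t : ℝ => t ^ n) =O[atTop]
      fun t => ((t : ℂ) ^ n / n !) • ((A - μ • 1) ^ n) v := by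
    refine IsBigO.of_bound (n ! * ‖((A - μ • 1) ^ n) v‖⁻¹) <| .of_forall fun t => le_of_eq ?_
    rw [norm_smul, norm_div, norm_pow, norm_pow, Complex.norm_real, Complex.norm_natCast]
    field_simp
  have hlow : (fun t : ℝ => ∑ k ∈ Finset.range n, ((t : ℂ) ^ k / k !) • ((A - μ • 1) ^ k) v)
      =o[atTop] fun t => ((t : ℂ) ^ n / n !) • ((A - μ • 1) ^ n) v :=
    (IsLittleO.fun_sum fun k hk => (ofReal_pow_div_smul_isBigO k _ _).trans_isLittleO
      (isLittleO_pow_pow_atTop_of_lt (Finset.mem_range.1 hk))).trans_isBigO hlead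
  refine (((isBigO_refl (fun t : ℝ => Complex.exp (t * μ)) atTop).smul_isLittleO hlow).congr_left
    fun t => ?_).congr_right fun t => smul_smul _ _ _
  rw [Pi.sub_apply, exp_smul_apply_of_pow_sub_smul_eq_zero h1, Finset.sum_range_succ, smul_add,
    smul_smul _ (_ / _), add_sub_cancel_right]

theorem exists_exp_smul_apply_isEquivalent [FiniteDimensional ℂ E]
    (hρ : ∀ μ, HasEigenvalue (A : E →ₗ[ℂ] E) μ → μ ≠ ρ → μ.re < ρ.re)
    (hv : v ∉ ⨆ (μ : ℂ) (_ : μ ≠ ρ), maxGenEigenspace (A : E →ₗ[ℂ] E) μ) :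
    ∃ (n : ℕ) (z : E), z ≠ 0 ∧ A z = ρ • z ∧
      (fun t : ℝ => NormedSpace.exp ((t : ℂ) • A) v) ~[atTop]
        fun t => (Complex.exp (t * ρ) * (t ^ n / n !)) • z := by
  have htop := iSup_maxGenEigenspace_eq_top (A : E →ₗ[ℂ] E)
  rw [iSup_split_single _ ρ] at htop
  obtain ⟨p, hp, q, hq, rfl⟩ := Submodule.mem_sup.1 (htop ▸ Submodule.mem_top : v ∈ _)
  have hp0 : p ≠ 0 := by
    rintro rfl
    exact hv (by rwa [zero_add])
  obtain ⟨n, hn, hn1⟩ : ∃ n : ℕ, ((A - ρ • 1) ^ n) p ≠ 0 ∧ ((A - ρ • 1) ^ (n + 1)) p = 0 := by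
    classical
    have hex := mem_maxGenEigenspace_iff_exists_pow_sub_smul.1 hp
    obtain ⟨n, hn⟩ := Nat.exists_eq_add_one_of_ne_zero (n := Nat.find hex) fun h => hp0 <| by
      have := Nat.find_spec hex
      rwa [h, pow_zero] at this
    exact ⟨n, Nat.find_min hex (hn ▸ n.lt_add_one), hn ▸ Nat.find_spec hex⟩
  refine ⟨n, _, hn, apply_pow_sub_smul_eq_smul hn1, ?_⟩
  simp only [map_add]
  exact (exp_smul_apply_isEquivalent_of_pow_sub_smul hn hn1).add_isLittleO
    ((exp_smul_apply_isLittleO_of_mem_iSup hq fun μ hne hμ => hρ μ hμ hne).trans_isBigO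
      (exp_re_mul_isBigO_exp_mul_pow_smul n hn ρ))

theorem exp_smul_apply_dominant [FiniteDimensional ℂ E]
    (hρ : ∀ μ, HasEigenvalue (A : E →ₗ[ℂ] E) μ → μ ≠ ρ → μ.re < ρ.re)
    (hv : v ∉ ⨆ (μ : ℂ) (_ : μ ≠ ρ), maxGenEigenspace (A : E →ₗ[ℂ] E) μ) :
    (fun t : ℝ => (A - ρ • 1) (NormedSpace.exp ((t : ℂ) • A) v)) =o[atTop]
        (fun t : ℝ => NormedSpace.exp ((t : ℂ) • A) v) ∧
      (fun t : ℝ => Real.exp (ρ.re * t)) =O[atTop]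
        fun t : ℝ => NormedSpace.exp ((t : ℂ) • A) v := by
  obtain ⟨n, z, hz, hAz, hy⟩ := exists_exp_smul_apply_isEquivalent hρ hv
  exact ⟨isLittleO_of_isEquivalent_smul hy (by simp [hAz]),
    (exp_re_mul_isBigO_exp_mul_pow_smul n hz ρ).trans hy.isBigO_symm⟩

end LinearFlow

section GenericVector

open Module.End

theorem iSup_maxGenEigenspace_ne_top {𝕜 V : Type*} [Field 𝕜] [AddCommGroup V] [Module 𝕜 V]
    {f : Module.End 𝕜 V} {ρ : 𝕜} (hρ : f.HasEigenvalue ρ) :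
    ⨆ (μ : 𝕜) (_ : μ ≠ ρ), f.maxGenEigenspace μ ≠ ⊤ := fun htop => by
  have hdisj := f.independent_maxGenEigenspace ρ
  rw [htop, disjoint_top] at hdisj
  exact hρ (eq_bot_mono eigenspace_le_maxGenEigenspace hdisj)

theorem ae_notMem_of_span_range_eq_top {V E : Type*} [NormedAddCommGroup V] [NormedSpace ℝ V]
    [FiniteDimensional ℝ V] [MeasurableSpace V] [BorelSpace V] (ν : Measure V)
    [ν.IsAddHaarMeasure] [AddCommGroup E] [Module ℂ E] {φ : V →ₗ[ℝ] E}
    (hφ : Submodule.span ℂ (Set.range φ) = ⊤) {S : Submodule ℂ E} (hS : S ≠ ⊤) :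
    ∀ᵐ x ∂ν, φ x ∉ S := by
  have hne : (S.restrictScalars ℝ).comap φ ≠ ⊤ := fun htop => hS <| top_unique <| by
    rw [← hφ, Submodule.span_le]
    rintro _ ⟨x, rfl⟩
    exact (htop ▸ Submodule.mem_top : x ∈ (S.restrictScalars ℝ).comap φ)
  rw [ae_iff]
  simp only [not_not]
  exact Measure.addHaar_submodule ν _ hne

end GenericVector

section Energy

variable {N K : ℕ} {G : Digraph (Fin N)} {x : Matrix (Fin N) (Fin K) ℝ}

theorem adj_nonneg (G : Digraph (Fin N)) (i j : Fin N) : 0 ≤ adj G i j := by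
  simp only [adj, of_apply]
  split_ifs <;> norm_num

theorem sna_apply (G : Digraph (Fin N)) (i j : Fin N) :
    sna G i j = (√(inDeg G i))⁻¹ * adj G i j * (√(outDeg G j))⁻¹ := by
  rw [sna, mul_diagonal, diagonal_mul]

theorem sna_nonneg (G : Digraph (Fin N)) (i j : Fin N) : 0 ≤ sna G i j := by
  rw [sna_apply]
  have := adj_nonneg G i j
  positivity

theorem trace_sna_eq_zero (hG : ∀ i, ¬ G.Adj i i) : (sna G).trace = 0 :=
  Finset.sum_eq_zero fun i _ => by simp [sna_apply, adj, hG i]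

theorem sna_bot : sna (⊥ : Digraph (Fin N)) = 0 := by
  ext i j
  simp [sna_apply, adj]

theorem inDeg_pos_of_adj {i j : Fin N} (h : G.Adj j i) : 0 < inDeg G i :=
  Finset.sum_pos' (fun k _ => adj_nonneg G i k) ⟨j, Finset.mem_univ j, by simp [adj, h]⟩

theorem outDeg_pos_of_adj {i j : Fin N} (h : G.Adj j i) : 0 < outDeg G j :=
  Finset.sum_pos' (fun k _ => adj_nonneg G k j) ⟨i, Finset.mem_univ i, by simp [adj, h]⟩

theorem StronglyConnected.eq_bot_or_degrees_pos (hG : StronglyConnected G) :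
    G = ⊥ ∨ ∀ i, 0 < inDeg G i ∧ 0 < outDeg G i := by
  by_cases hadj : ∃ a b, G.Adj a b
  · obtain ⟨a, b, hab⟩ := hadj
    refine .inr fun i => ⟨?_, ?_⟩
    · obtain rfl | ⟨j, -, hj⟩ := Relation.ReflTransGen.cases_tail (hG b i)
      exacts [inDeg_pos_of_adj hab, inDeg_pos_of_adj hj]
    · obtain rfl | ⟨j, hj, -⟩ := Relation.ReflTransGen.cases_head (hG i a)
      exacts [outDeg_pos_of_adj hab, outDeg_pos_of_adj hj]
  · push Not at hadj
    exact .inl (by ext a b; simp [hadj a b])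

theorem frob_sq (x : Matrix (Fin N) (Fin K) ℝ) : frob x ^ 2 = ∑ i, ∑ k, x i k ^ 2 :=
  Real.sq_sqrt (Finset.sum_nonneg fun _ _ => Finset.sum_nonneg fun _ _ => sq_nonneg _)

theorem abs_le_frob (x : Matrix (Fin N) (Fin K) ℝ) (i : Fin N) (k : Fin K) :
    |x i k| ≤ frob x :=
  Real.abs_le_sqrt <|
    (Finset.single_le_sum (f := fun k => x i k ^ 2) (fun _ _ => sq_nonneg _)
      (Finset.mem_univ k)).trans <|
    Finset.single_le_sum (f := fun i => ∑ k, x i k ^ 2)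
      (fun _ _ => Finset.sum_nonneg fun _ _ => sq_nonneg _) (Finset.mem_univ i)

theorem dirichletEnergy_smul (G : Digraph (Fin N)) (c : ℝ) (x : Matrix (Fin N) (Fin K) ℝ) :
    dirichletEnergy G (c • x) = c ^ 2 * dirichletEnergy G x := by
  simp only [dirichletEnergy, Matrix.smul_apply, smul_eq_mul, Finset.mul_sum]
  refine Finset.sum_congr rfl fun i _ => Finset.sum_congr rfl fun j _ =>
    Finset.sum_congr rfl fun k _ => ?_
  ring

theorem sum_adj_mul_div_inDeg (hin : ∀ i, 0 < inDeg G i) (f : Fin N → ℝ) :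
    ∑ i, ∑ j, adj G i j * (f i / inDeg G i) = ∑ i, f i :=
  Finset.sum_congr rfl fun i _ => by
    rw [← Finset.sum_mul]
    exact mul_div_cancel₀ _ (hin i).ne'

theorem sum_adj_mul_div_outDeg (hout : ∀ j, 0 < outDeg G j) (f : Fin N → ℝ) :
    ∑ i, ∑ j, adj G i j * (f j / outDeg G j) = ∑ j, f j := by
  rw [Finset.sum_comm]
  refine Finset.sum_congr rfl fun j _ => ?_
  rw [← Finset.sum_mul]
  exact mul_div_cancel₀ _ (hout j).ne'

theorem dirichletEnergy_eq (hdeg : ∀ i, 0 < inDeg G i ∧ 0 < outDeg G i)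
    (x : Matrix (Fin N) (Fin K) ℝ) :
    dirichletEnergy G x = 1 / 2 * (frob x ^ 2 - ∑ i, ∑ k, x i k * (sna G * x) i k) := by
  have hterm : ∀ i j, adj G i j * ∑ k, (x i k / √(inDeg G i) - x j k / √(outDeg G j)) ^ 2 =
      adj G i j * ((∑ k, x i k ^ 2) / inDeg G i) + adj G i j * ((∑ k, x j k ^ 2) / outDeg G j)
        - 2 * ∑ k, x i k * (sna G i j * x j k) := fun i j => by
    simp only [Finset.mul_sum, Finset.sum_div, ← Finset.sum_add_distrib, ← Finset.sum_sub_distrib]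
    refine Finset.sum_congr rfl fun k _ => ?_
    rw [sna_apply, sub_sq, div_pow, div_pow, Real.sq_sqrt (hdeg i).1.le,
      Real.sq_sqrt (hdeg j).2.le]
    ring
  have hcross : ∑ i, ∑ j, ∑ k, x i k * (sna G i j * x j k) =
      ∑ i, ∑ k, x i k * (sna G * x) i k := Finset.sum_congr rfl fun i _ => by
    rw [Finset.sum_comm]
    simp only [mul_apply, Finset.mul_sum]
  simp only [dirichletEnergy, hterm, Finset.sum_add_distrib, Finset.sum_sub_distrib,
    sum_adj_mul_div_inDeg fun i => (hdeg i).1, sum_adj_mul_div_outDeg fun i => (hdeg i).2,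
    ← Finset.mul_sum, hcross, frob_sq]
  ring

theorem dirichletEnergy_normalized (hdeg : ∀ i, 0 < inDeg G i ∧ 0 < outDeg G i)
    (hx : frob x ≠ 0) (r : ℝ) :
    dirichletEnergy G (normalized x) = (1 - r) / 2 -
      (∑ i, ∑ k, x i k * (sna G * x - r • x) i k) / frob x ^ 2 / 2 := by
  have hsum : ∑ i, ∑ k, x i k * (sna G * x - r • x) i k =
      ∑ i, ∑ k, x i k * (sna G * x) i k - r * frob x ^ 2 := by
    rw [frob_sq]
    simp only [Matrix.sub_apply, Matrix.smul_apply, smul_eq_mul, mul_sub,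
      Finset.sum_sub_distrib, Finset.mul_sum, sq, mul_left_comm r]
  rw [normalized, dirichletEnergy_smul, dirichletEnergy_eq hdeg, hsum]
  field_simp
  ring

end Energy

section HeatFlow

open Asymptotics Module.End

variable {N K : ℕ} {G : Digraph (Fin N)} {w : Fin K → ℝ} {x₀ : Matrix (Fin N) (Fin K) ℝ}
  {x : ℝ → Matrix (Fin N) (Fin K) ℝ} {r : ℝ} {k : Fin K}

/-- The symmetrically normalized adjacency as an operator on complex vectors. -/
noncomputable def snaOp (G : Digraph (Fin N)) : (Fin N → ℂ) →L[ℂ] (Fin N → ℂ) :=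
  LinearMap.toContinuousLinearMap (toLin' ((sna G).map (fun a : ℝ => (a : ℂ))))

/-- The `k`-th column of the real features `x` as a complex vector. For diagonal `W` the heat
equation decouples into one linear equation for each of these columns. -/
noncomputable def complexCol (k : Fin K) : Matrix (Fin N) (Fin K) ℝ →ₗ[ℝ] (Fin N → ℂ) :=
  LinearMap.pi fun i => Complex.ofRealCLM.toLinearMap ∘ₗ Matrix.entryLinearMap ℝ ℝ i k

theorem complexCol_apply (k : Fin K) (x : Matrix (Fin N) (Fin K) ℝ) (i : Fin N) :
    complexCol k x i = x i k := rfl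

theorem snaOp_complexCol (G : Digraph (Fin N)) (k : Fin K) (x : Matrix (Fin N) (Fin K) ℝ) :
    snaOp G (complexCol k x) = complexCol k (sna G * x) := by
  ext i
  simp [snaOp, complexCol_apply, mulVec, dotProduct, Matrix.mul_apply]

theorem complexCol_mul_sub_smul (G : Digraph (Fin N)) (k : Fin K) (r : ℝ)
    (x : Matrix (Fin N) (Fin K) ℝ) :
    complexCol k (sna G * x - r • x) = (snaOp G - (r : ℂ) • 1) (complexCol k x) := by
  rw [map_sub, map_smul, ← snaOp_complexCol]
  simp

theorem span_range_complexCol (k : Fin K) :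
    Submodule.span ℂ (Set.range (complexCol (N := N) k)) = ⊤ := by
  refine eq_top_iff.2 fun v _ => ?_
  have hv : v = complexCol k (of fun i _ => (v i).re) +
      Complex.I • complexCol k (of fun i _ => (v i).im) := by
    ext i
    simp only [Pi.add_apply, Pi.smul_apply, complexCol_apply, of_apply, smul_eq_mul]
    rw [mul_comm, Complex.re_add_im]
  rw [hv]
  exact add_mem (Submodule.subset_span ⟨_, rfl⟩)
    (Submodule.smul_mem _ _ (Submodule.subset_span ⟨_, rfl⟩))

theorem ae_complexCol_notMem {f : Module.End ℂ (Fin N → ℂ)} {ρ : ℂ} (hρ : f.HasEigenvalue ρ)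
    (k : Fin K) : ∀ᵐ x₀ : Fin N → Fin K → ℝ,
      complexCol k (of x₀) ∉ ⨆ (μ : ℂ) (_ : μ ≠ ρ), f.maxGenEigenspace μ := by
  have : (volume : Measure (Fin N → Fin K → ℝ)).IsAddHaarMeasure :=
    Measure.pi.isAddHaarMeasure fun _ => volume
  refine ae_notMem_of_span_range_eq_top (φ := complexCol k ∘ₗ (ofLinearEquiv ℝ).toLinearMap)
    volume ?_ (iSup_maxGenEigenspace_ne_top hρ)
  rw [LinearMap.coe_comp, LinearEquiv.coe_coe, (ofLinearEquiv ℝ).surjective.range_comp,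
    span_range_complexCol]

theorem hasEigenvalue_smul_snaOp_iff [NeZero N] {c ν : ℂ} :
    HasEigenvalue ((c • snaOp G : (Fin N → ℂ) →L[ℂ] (Fin N → ℂ)) : Module.End ℂ (Fin N → ℂ)) ν ↔
      ∃ μ ∈ eigenvalues (sna G), c * μ = ν := by
  rw [hasEigenvalue_iff_mem_spectrum, ContinuousLinearMap.toLinearMap_smul,
    spectrum.smul_eq_smul _ _ (spectrum.nonempty_of_isAlgClosed_of_finiteDimensional ℂ _)]
  simp [snaOp, spectrum_toLin', eigenvalues, Set.mem_smul_set]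

theorem IsHeatSolution.complexCol_eq_exp (hx : IsHeatSolution G (diagonal w) x₀ x) (k : Fin K)
    {t : ℝ} (ht : 0 ≤ t) : complexCol k (x t) =
      NormedSpace.exp ((t : ℂ) • (-w k : ℂ) • snaOp G) (complexCol k x₀) := by
  rw [← hx.1]
  refine eq_exp_smul_apply (y := fun t => complexCol k (x t)) (fun t ht => ?_) ht
  refine hasDerivWithinAt_pi.2 fun i => ?_
  refine (Complex.ofRealCLM.hasFDerivAt.comp_hasDerivWithinAt t (hx.2 t ht i k)).congr_deriv ?_
  rw [_root_.smul_apply, Pi.smul_apply, snaOp_complexCol, complexCol_apply, Matrix.neg_apply,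
    mul_diagonal]
  simp [mul_comm]

theorem exists_isHeatSolution (G : Digraph (Fin N)) (w : Fin K → ℝ)
    (x₀ : Matrix (Fin N) (Fin K) ℝ) : ∃ x, IsHeatSolution G (diagonal w) x₀ x := by
  set y : Fin K → ℝ → Fin N → ℂ := fun k t =>
    NormedSpace.exp ((t : ℂ) • (-w k : ℂ) • snaOp G) (complexCol k x₀)
  refine ⟨fun t => of fun i k => (y k t i).re, ?_, fun t _ i k => ?_⟩
  · ext i k
    have hy : y k 0 = complexCol k x₀ := by
      simp only [y]
      rw [Complex.ofReal_zero, zero_smul ℂ (_ : (Fin N → ℂ) →L[ℂ] (Fin N → ℂ)),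
        NormedSpace.exp_zero, one_apply_eq_self]
    simp only [of_apply, hy, complexCol_apply, Complex.ofReal_re]
  · have hderiv : HasDerivAt (y k) (((-w k : ℂ) • snaOp G) (y k t)) t :=
      hasDerivAt_exp_smul_apply _ _ t
    refine (Complex.reCLM.hasFDerivAt.comp_hasDerivWithinAt t
      (hasDerivAt_pi.1 hderiv i).hasDerivWithinAt).congr_deriv ?_
    rw [Matrix.neg_apply, mul_diagonal, Matrix.mul_apply]
    simp [snaOp, mulVec, dotProduct, mul_comm]

theorem complexCol_isBigO_frob (x : ℝ → Matrix (Fin N) (Fin K) ℝ) (k : Fin K) :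
    (fun t => complexCol k (x t)) =O[atTop] fun t => frob (x t) :=
  isBigO_pi.2 fun i => IsBigO.of_bound' <| .of_forall fun t => by
    rw [complexCol_apply, Complex.norm_real]
    exact (abs_le_frob (x t) i k).trans (le_abs_self _)

theorem isFreqDominant_of_isLittleO (hdeg : ∀ i, 0 < inDeg G i ∧ 0 < outDeg G i)
    (h0 : ∀ᶠ t in atTop, frob (x t) ≠ 0)
    (h : ∀ k, (fun t => complexCol k (sna G * x t - r • x t)) =o[atTop] fun t => frob (x t)) :
    IsFreqDominant G x (1 - r) := by
  have hentry : ∀ i k, (fun t => x t i k * (sna G * x t - r • x t) i k) =o[atTop]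
      fun t => frob (x t) ^ 2 := fun i k => by
    have hx : (fun t => x t i k) =O[atTop] fun t => frob (x t) :=
      .of_norm_left (by
        simpa [complexCol_apply] using (isBigO_pi.1 (complexCol_isBigO_frob x k) i).norm_left)
    have hres := isLittleO_pi.1 (h k) i
    simp only [complexCol_apply, Complex.isLittleO_ofReal_left] at hres
    simpa only [sq] using hx.mul_isLittleO hres
  have hsum : (fun t => ∑ i, ∑ k, x t i k * (sna G * x t - r • x t) i k) =o[atTop]
      fun t => frob (x t) ^ 2 := .fun_sum fun i _ => .fun_sum fun k _ => hentry i k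
  have hlim := (hsum.tendsto_div_nhds_zero.div_const 2).const_sub ((1 - r) / 2)
  rw [zero_div, sub_zero] at hlim
  refine hlim.congr' ?_
  filter_upwards [h0] with t ht
  exact (dirichletEnergy_normalized hdeg ht r).symm

theorem isFreqDominant_of_isBigO_exp (hdeg : ∀ i, 0 < inDeg G i ∧ 0 < outDeg G i) {c : ℝ}
    (hexp : (fun t => Real.exp (c * t)) =O[atTop] fun t => frob (x t))
    (h : ∀ k, (fun t => complexCol k (sna G * x t - r • x t)) =o[atTop]
        (fun t => complexCol k (x t)) ∨
      (fun t => complexCol k (x t)) =o[atTop] fun t => Real.exp (c * t)) :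
    IsFreqDominant G x (1 - r) := by
  refine isFreqDominant_of_isLittleO hdeg (hexp.eq_zero_imp.mono fun t ht h0 =>
    (Real.exp_pos _).ne' (ht h0)) fun k => ?_
  rcases h k with hdom | hdecay
  · exact hdom.trans_isBigO (complexCol_isBigO_frob x k)
  · simp only [complexCol_mul_sub_smul]
    exact ((snaOp G - (r : ℂ) • 1).isBigO_comp _ _).trans_isLittleO hdecay |>.trans_isBigO hexp

theorem IsHeatSolution.complexCol_dominant [NeZero N] (hx : IsHeatSolution G (diagonal w) x₀ x)
    (hw : w k ≠ 0) (hr : ∀ μ ∈ eigenvalues (sna G), μ ≠ r → -w k * μ.re < -w k * r)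
    (hx₀ : complexCol k x₀ ∉ ⨆ (ν : ℂ) (_ : ν ≠ -w k * r),
      maxGenEigenspace ((-w k : ℂ) • snaOp G : (Fin N → ℂ) →L[ℂ] (Fin N → ℂ)).toLinearMap ν) :
    (fun t => complexCol k (sna G * x t - r • x t)) =o[atTop] (fun t => complexCol k (x t)) ∧
      (fun t => Real.exp (-w k * r * t)) =O[atTop] fun t => complexCol k (x t) := by
  have hdom := exp_smul_apply_dominant (fun ν hν hne => ?_) hx₀
  · have hflow : ∀ᶠ t : ℝ in atTop, NormedSpace.exp ((t : ℂ) • (-w k : ℂ) • snaOp G)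
        (complexCol k x₀) = complexCol k (x t) := by
      filter_upwards [eventually_ge_atTop 0] with t ht using (hx.complexCol_eq_exp k ht).symm
    refine ⟨?_, (hdom.2.congr' (.of_forall fun t => by simp) hflow)⟩
    have hres := hdom.1.congr' (hflow.mono fun t ht => congrArg _ ht) hflow
    refine (isLittleO_const_smul_left (neg_ne_zero.2 (Complex.ofReal_ne_zero.2 hw))).1
      (hres.congr_left fun t => ?_)
    rw [complexCol_mul_sub_smul, mul_smul, ← smul_sub, _root_.smul_apply]
  · obtain ⟨μ, hμ, rfl⟩ := hasEigenvalue_smul_snaOp_iff.1 hν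
    simpa using hr μ hμ fun h => hne (by rw [h])

theorem IsHeatSolution.complexCol_isLittleO [NeZero N] (hx : IsHeatSolution G (diagonal w) x₀ x)
    {c : ℝ} (hc : ∀ μ ∈ eigenvalues (sna G), -w k * μ.re < c) :
    (fun t => complexCol k (x t)) =o[atTop] fun t => Real.exp (c * t) := by
  have hmem : complexCol k x₀ ∈ ⨆ (ν : ℂ) (_ : True), maxGenEigenspace
      ((-w k : ℂ) • snaOp G : (Fin N → ℂ) →L[ℂ] (Fin N → ℂ)).toLinearMap ν := by
    simp only [iSup_pos, iSup_maxGenEigenspace_eq_top, Submodule.mem_top]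
  refine (exp_smul_apply_isLittleO_of_mem_iSup hmem fun ν _ hν => ?_).congr' ?_ .rfl
  · obtain ⟨μ, hμ, rfl⟩ := hasEigenvalue_smul_snaOp_iff.1 hν
    simpa using hc μ hμ
  · filter_upwards [eventually_ge_atTop 0] with t ht using (hx.complexCol_eq_exp k ht).symm

theorem ae_isFreqDominant [NeZero N] (hdeg : ∀ i, 0 < inDeg G i ∧ 0 < outDeg G i)
    (hr : (r : ℂ) ∈ eigenvalues (sna G)) (k₀ : Fin K)
    (h : ∀ k, (w k ≠ 0 ∧ ∀ μ ∈ eigenvalues (sna G), μ ≠ r → -w k * μ.re < -w k * r) ∨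
      ∀ μ ∈ eigenvalues (sna G), -w k * μ.re < -w k₀ * r) :
    ∀ᵐ x₀ : Fin N → Fin K → ℝ, (∃ x, IsHeatSolution G (diagonal w) (of x₀) x) ∧
      ∀ x, IsHeatSolution G (diagonal w) (of x₀) x → IsFreqDominant G x (1 - r) := by
  have heig : ∀ k, HasEigenvalue
      ((-w k : ℂ) • snaOp G : (Fin N → ℂ) →L[ℂ] (Fin N → ℂ)).toLinearMap (-w k * r) := fun k =>
    hasEigenvalue_smul_snaOp_iff.2 ⟨r, hr, rfl⟩
  filter_upwards [ae_all_iff.2 fun k => ae_complexCol_notMem (heig k) k] with x₀ hx₀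
  refine ⟨exists_isHeatSolution G w _, fun x hx => ?_⟩
  have hk₀ := (h k₀).resolve_right fun h => (h r hr).false
  refine isFreqDominant_of_isBigO_exp hdeg (c := -w k₀ * r)
    ((hx.complexCol_dominant hk₀.1 hk₀.2 (hx₀ k₀)).2.trans (complexCol_isBigO_frob x k₀))
    fun k => ?_
  exact (h k).imp (fun hk => (hx.complexCol_dominant hk.1 hk.2 (hx₀ k)).1) hx.complexCol_isLittleO

theorem IsLowestEigenvalue.re_nonpos_of_no_loops [NeZero N] {l : ℂ}
    (hl : IsLowestEigenvalue (sna G) l) (hG : ∀ i, ¬ G.Adj i i) : l.re ≤ 0 :=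
  nonpos_of_mul_nonpos_right (hl.card_mul_re_le_trace.trans_eq (trace_sna_eq_zero hG))
    (Nat.cast_pos.2 (NeZero.pos N))

theorem eq_zero_of_mem_eigenvalues_sna_bot [NeZero N] {l : ℂ}
    (hl : l ∈ eigenvalues (sna (⊥ : Digraph (Fin N)))) : l = 0 := by
  rwa [sna_bot, eigenvalues, Matrix.map_zero _ Complex.ofReal_zero, spectrum.zero_eq] at hl

theorem ae_isHFD [NeZero N] {l₁ l_N : ℂ} {w₁ w_K : ℝ}
    (hdeg : ∀ i, 0 < inDeg G i ∧ 0 < outDeg G i)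
    (hl₁ : IsLowestEigenvalue (sna G) l₁) (hl_N : IsHighestEigenvalue (sna G) l_N)
    (hw₁ : IsLeast (Set.range w) w₁) (hw_K : IsGreatest (Set.range w) w_K)
    (huniq : ∀ μ ∈ eigenvalues (sna G), μ.re = l₁.re → μ = l₁)
    (hlt : w_K * l₁.re < w₁ * l_N.re) :
    ∀ᵐ x₀ : Fin N → Fin K → ℝ, (∃ x, IsHeatSolution G (diagonal w) (of x₀) x) ∧
      ∀ x, IsHeatSolution G (diagonal w) (of x₀) x → IsHFD G x := by
  obtain ⟨k₀, rfl⟩ := hw_K.1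
  have hreal : (l₁.re : ℂ) = l₁ := Complex.conj_eq_iff_re.1 <|
    huniq _ (conj_mem_eigenvalues hl₁.1) (Complex.conj_re l₁)
  have hl_N0 : 0 ≤ l_N.re := (norm_nonneg l_N).trans (hl_N.norm_le (sna_nonneg G) hl_N.1)
  refine (ae_isFreqDominant hdeg (hreal ▸ hl₁.1) k₀ fun k => ?_).mono fun x₀ hx₀ =>
    ⟨hx₀.1, fun x hx => ⟨1 - l₁, hl₁.one_sub, by simpa using hx₀.2 x hx⟩⟩
  obtain hk | hk := lt_or_ge 0 (w k)
  · refine .inl ⟨hk.ne', fun μ hμ hne => ?_⟩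
    have hμl : l₁.re < μ.re := lt_of_le_of_ne (hl₁.2 μ hμ) fun h =>
      hne (by rw [hreal]; exact huniq μ hμ h.symm)
    exact mul_lt_mul_of_neg_left hμl (neg_neg_of_pos hk)
  · refine .inr fun μ hμ => ?_
    have hμ : w k * l_N.re ≤ w k * μ.re := mul_le_mul_of_nonpos_left (hl_N.2 μ hμ) hk
    have hw : w₁ * l_N.re ≤ w k * l_N.re :=
      mul_le_mul_of_nonneg_right (hw₁.2 ⟨k, rfl⟩) hl_N0
    linarith

theorem ae_isLFD [NeZero N] {l₁ l_N : ℂ} {w₁ w_K : ℝ}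
    (hdeg : ∀ i, 0 < inDeg G i ∧ 0 < outDeg G i)
    (hl₁ : IsLowestEigenvalue (sna G) l₁) (hl_N : IsHighestEigenvalue (sna G) l_N)
    (hw₁ : IsLeast (Set.range w) w₁) (hw_K : IsGreatest (Set.range w) w_K)
    (hl₁0 : l₁.re ≤ 0) (hlt : w₁ * l_N.re < w_K * l₁.re) :
    ∀ᵐ x₀ : Fin N → Fin K → ℝ, (∃ x, IsHeatSolution G (diagonal w) (of x₀) x) ∧
      ∀ x, IsHeatSolution G (diagonal w) (of x₀) x → IsLFD G x := by
  obtain ⟨k₀, rfl⟩ := hw₁.1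
  have hreal : l_N = l_N.re := hl_N.eq_re_of_re_eq (sna_nonneg G) hl_N.1 rfl
  refine (ae_isFreqDominant hdeg (hreal ▸ hl_N.1) k₀ fun k => ?_).mono fun x₀ hx₀ =>
    ⟨hx₀.1, fun x hx => ⟨1 - l_N, hl_N.one_sub, by simpa using hx₀.2 x hx⟩⟩
  obtain hk | hk := lt_or_ge (w k) 0
  · refine .inl ⟨hk.ne, fun μ hμ hne => ?_⟩
    have hμl : μ.re < l_N.re := lt_of_le_of_ne (hl_N.2 μ hμ) fun h =>
      hne (hl_N.eq_re_of_re_eq (sna_nonneg G) hμ h)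
    exact mul_lt_mul_of_pos_left hμl (neg_pos_of_neg hk)
  · refine .inr fun μ hμ => ?_
    have hμ : w k * l₁.re ≤ w k * μ.re := mul_le_mul_of_nonneg_left (hl₁.2 μ hμ) hk
    have hw : w_K * l₁.re ≤ w k * l₁.re :=
      mul_le_mul_of_nonpos_right (hw_K.2 ⟨k, rfl⟩) hl₁0
    linarith

end HeatFlow

end FracGraph

theorem theorem5p5_general (N K : ℕ) [NeZero N] (G : Digraph (Fin N))
    (hG : G = ⊥ ∨ ∀ i, 0 < FracGraph.inDeg G i ∧ 0 < FracGraph.outDeg G i)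
    (W : Matrix (Fin K) (Fin K) ℝ) (hW : W.IsDiag)
    (l1 lN : ℂ)
    (hl1 : FracGraph.IsLowestEigenvalue (FracGraph.sna G) l1)
    (hlN : FracGraph.IsHighestEigenvalue (FracGraph.sna G) lN)
    (w1 wK : ℝ)
    (hw1 : FracGraph.IsLowestEigenvalue W (w1 : ℂ))
    (hwK : FracGraph.IsHighestEigenvalue W (wK : ℂ)) :
    lN.im = 0 ∧
    ((∀ μ ∈ FracGraph.eigenvalues (FracGraph.sna G), μ.re = l1.re → μ = l1) →
      wK * l1.re < w1 * lN.re →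
      ∀ᵐ x₀ : Fin N → Fin K → ℝ,
        (∃ x, FracGraph.IsHeatSolution G W (Matrix.of x₀) x) ∧
        ∀ x, FracGraph.IsHeatSolution G W (Matrix.of x₀) x → FracGraph.IsHFD G x) ∧
    (((∀ i, ¬ G.Adj i i) ∨ l1.re ≤ 0) →
      w1 * lN.re < wK * l1.re →
      ∀ᵐ x₀ : Fin N → Fin K → ℝ,
        (∃ x, FracGraph.IsHeatSolution G W (Matrix.of x₀) x) ∧
        ∀ x, FracGraph.IsHeatSolution G W (Matrix.of x₀) x → FracGraph.IsLFD G x) := by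
  obtain ⟨w, rfl⟩ : ∃ w, W = Matrix.diagonal w := ⟨W.diag, hW.diagonal_diag.symm⟩
  rw [FracGraph.isLowestEigenvalue_diagonal_iff] at hw1
  rw [FracGraph.isHighestEigenvalue_diagonal_iff] at hwK
  have hdeg : wK * l1.re ≠ w1 * lN.re →
      ∀ i, 0 < FracGraph.inDeg G i ∧ 0 < FracGraph.outDeg G i := fun hne =>
    hG.resolve_left fun hbot => hne <| by
      subst hbot
      simp [FracGraph.eq_zero_of_mem_eigenvalues_sna_bot hl1.1,
        FracGraph.eq_zero_of_mem_eigenvalues_sna_bot hlN.1]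
  refine ⟨?_, fun huniq hlt => ?_, fun hloop hlt => ?_⟩
  · rw [hlN.eq_re_of_re_eq (FracGraph.sna_nonneg G) hlN.1 rfl, Complex.ofReal_im]
  · exact FracGraph.ae_isHFD (hdeg hlt.ne) hl1 hlN hw1 hwK huniq hlt
  · exact FracGraph.ae_isLFD (hdeg hlt.ne') hl1 hlN hw1 hwK
      (hloop.elim hl1.re_nonpos_of_no_loops id) hlt

theorem theorem5p5 (N K : ℕ) [NeZero N] [NeZero K] (G : Digraph (Fin N))
    (hG : FracGraph.StronglyConnected G)
    (W : Matrix (Fin K) (Fin K) ℝ) (hW : W.IsDiag)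
    -- `l1`, `lN` are `λ₁(L)`, `λ_N(L)`, and `w1`, `wK` are `λ₁(W)`, `λ_K(W)`
    (l1 lN : ℂ)
    (hl1 : FracGraph.IsLowestEigenvalue (FracGraph.sna G) l1)
    (hlN : FracGraph.IsHighestEigenvalue (FracGraph.sna G) lN)
    (w1 wK : ℝ)
    (hw1 : FracGraph.IsLowestEigenvalue W (w1 : ℂ))
    (hwK : FracGraph.IsHighestEigenvalue W (wK : ℂ)) :
    lN.im = 0 ∧
    ((∀ μ ∈ FracGraph.eigenvalues (FracGraph.sna G), μ.re = l1.re → μ = l1) →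
      wK * l1.re < w1 * lN.re →
      ∀ᵐ x₀ : Fin N → Fin K → ℝ,
        (∃ x, FracGraph.IsHeatSolution G W (Matrix.of x₀) x) ∧
        ∀ x, FracGraph.IsHeatSolution G W (Matrix.of x₀) x → FracGraph.IsHFD G x) ∧
    (((∀ i, ¬ G.Adj i i) ∨ l1.re ≤ 0) →
      w1 * lN.re < wK * l1.re →
      ∀ᵐ x₀ : Fin N → Fin K → ℝ,
        (∃ x, FracGraph.IsHeatSolution G W (Matrix.of x₀) x) ∧
        ∀ x, FracGraph.IsHeatSolution G W (Matrix.of x₀) x → FracGraph.IsLFD G x) :=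
  theorem5p5_general N K G hG.eq_bot_or_degrees_pos W hW l1 lN hl1 hlN w1 wK hw1 hwK
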